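/- Let $f:(0,\infty)\to\mathbb{R}$ be operator anti-monotone: $A\le B$ implies $f(B)\le f(A)$ for all positive definite complex matrices $A,B$ of the same, arbitrary, finite size. Let $X$ and $Y$ be positive definite operators on a finite-dimensional complex Hilbert space $\mathcal{H}_S\neq\{0\}$ with an orthonormal basis $\{|i\rangle\}_i$. Let $\mathcal{H}_{\hat S}$ be a copy of $\mathcal{H}_S$, let $|\Gamma\rangle=\sum_i|i\rangle_S\otimes|i\rangle_{\hat S}$ and $|\varphi^X\rangle=(X^{1/2}\otimes I)|\Gamma\rangle$, let $T$ denote the transpose with respect to this basis, and, for positive definite $\tau$ on $\mathcal{H}_S$, set $$\widetilde{Q}_f(X\Vert Y;\tau)=\langle\varphi^X|\,f(\tau^{-1}\otimes Y^T)\,|\varphi^X\rangle,\qquad \widetilde{Q}_f(X\Vert Y)=\sup_{\tau>0,\ \operatorname{Tr}\tau\le1}\widetilde{Q}_f(X\Vert Y;\tau).$$ Then $$\widetilde{Q}_f(X\Vert Y)=\sup_{\tau>0,\ \operatorname{Tr}\tau=1}\widetilde{Q}_f(X\Vert Y;\tau),$$ and the function $\tau\mapsto\widetilde{Q}_f(X\Vert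 Y;\tau)$ is concave on the set of all positive definite operators $\tau$ on $\mathcal{H}_S$. -/

import Mathlib

open scoped ComplexOrder MatrixOrder Kronecker

/-- A function `f : (0,∞) → ℝ` (only its values on `(0,∞)` matter) is operator anti-monotone if
`A ≤ B` implies `f(B) ≤ f(A)` in the Loewner order, for all Hermitian matrices `A`, `B` of the same,
arbitrary, finite order whose spectra lie in `(0,∞)`, that is, for all positive definite ones.
Here `cfc f A` is the functional calculus of the Hermitian matrix `A`. -/
def OperatorAntiMonotone (f : ℝ → ℝ) : Prop :=
  ∀ (k : ℕ) (A B : Matrix (Fin k) (Fin k) ℂ),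
    A.PosDef → B.PosDef → A ≤ B → cfc f B ≤ cfc f A

/-- The vector `|Γ⟩ = ∑ i, |i⟩ ⊗ |i⟩`, in coordinates. -/
def gammaVec (n : Type*) [DecidableEq n] : n × n → ℂ :=
  fun p => if p.1 = p.2 then 1 else 0

/-- The vector `|φ^X⟩ = (X^{1/2} ⊗ I) |Γ⟩`. -/
noncomputable def phiVec {n : Type*} [Fintype n] [DecidableEq n] (X : Matrix n n ℂ) : n × n → ℂ :=
  (CFC.sqrt X ⊗ₖ (1 : Matrix n n ℂ)).mulVec (gammaVec n)

/-- `Q̃_f(X‖Y;τ) = ⟨φ^X| f(τ⁻¹ ⊗ Yᵀ) |φ^X⟩`. This number is real, because the matrix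
`f(τ⁻¹ ⊗ Yᵀ)` is Hermitian; taking the real part only casts it to `ℝ`. -/
noncomputable def optQAt {n : Type*} [Fintype n] [DecidableEq n]
    (f : ℝ → ℝ) (X Y τ : Matrix n n ℂ) : ℝ :=
  (star (phiVec X) ⬝ᵥ (cfc f (τ⁻¹ ⊗ₖ Y.transpose)).mulVec (phiVec X)).re

/-- The optimized quantum `f`-divergence, the supremum of `Q̃_f(X‖Y;τ)` over all `τ > 0` with
`Tr τ ≤ 1`, taken in the extended reals. -/
noncomputable def optQ {n : Type*} [Fintype n] [DecidableEq n]
    (f : ℝ → ℝ) (X Y : Matrix n n ℂ) : EReal :=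
  ⨆ τ ∈ {τ : Matrix n n ℂ | τ.PosDef ∧ τ.trace ≤ 1}, (optQAt f X Y τ : EReal)

open Matrix
open scoped Polynomial

/-! Put `g x = f x⁻¹`. Inversion reverses the Loewner order on positive definite matrices, so `g` is
operator monotone. Since `τ⁻¹ ⊗ Yᵀ` is the inverse of `τ ⊗ (Yᵀ)⁻¹`, the divergence is a quadratic
form of `g` at an argument linear in `τ`. Monotonicity (`optQAt_mono`) lets `τ` be enlarged to trace
one; operator concavity of `g` (`smul_cfc_inv_add_le`) gives concavity in `τ`. That concavity comes
from monotonicity by a 2×2 block argument: a unitary conjugate of `diag(A, B)` has corner `a • A + b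
• B` and lies below a block diagonal matrix with corner enlarged by `ε`. The `ε` is removed by right
continuity of `g`, itself a consequence of the scalar case. -/

/-- On a finite set every real function agrees with a polynomial. -/
lemma Set.Finite.exists_polynomial_eqOn {s : Set ℝ} (hs : s.Finite) (g : ℝ → ℝ) :
    ∃ p : ℝ[X], s.EqOn g (fun x => p.eval x) := by
  refine ⟨Lagrange.interpolate hs.toFinset id g, fun x hx => ?_⟩
  exact (Lagrange.eval_interpolate_at_node (v := id) g Function.injective_id.injOn
    (hs.mem_toFinset.2 hx)).symm

/-! ### Functional calculus and Loewner order for matrices. -/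

namespace Matrix

variable {m k : Type*} [Fintype m] [DecidableEq m] [Fintype k] [DecidableEq k]

lemma cfc_eq_aeval {A : Matrix m m ℂ} (hA : A.IsHermitian) {g : ℝ → ℝ} {p : ℝ[X]}
    (h : (spectrum ℝ A).EqOn g (fun x => p.eval x)) : cfc g A = Polynomial.aeval A p := by
  rw [cfc_congr h, cfc_polynomial p A hA.isSelfAdjoint]

/-- Spectra are finite, so `g` acts as a polynomial and needs no continuity; the homomorphism can
only shrink the spectrum. -/
lemma map_cfc {A : Matrix m m ℂ} (φ : Matrix m m ℂ →ₐ[ℝ] Matrix k k ℂ) (hA : A.IsHermitian)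
    (hφ : (φ A).IsHermitian) (g : ℝ → ℝ) : φ (cfc g A) = cfc g (φ A) := by
  obtain ⟨p, hp⟩ := (finite_real_spectrum (A := A)).exists_polynomial_eqOn g
  rw [cfc_eq_aeval hA hp, cfc_eq_aeval hφ (hp.mono (AlgHom.spectrum_apply_subset φ A)),
    Polynomial.aeval_algHom_apply]

lemma cfc_submatrix_equiv {A : Matrix m m ℂ} (hA : A.IsHermitian) (e : k ≃ m) (g : ℝ → ℝ) :
    cfc g (A.submatrix e e) = (cfc g A).submatrix e e :=
  (map_cfc (reindexAlgEquiv ℝ ℂ e.symm : Matrix m m ℂ →ₐ[ℝ] Matrix k k ℂ) hA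
    (hA.submatrix e) g).symm

lemma aeval_fromBlocks_diagonal (A : Matrix m m ℂ) (B : Matrix k k ℂ) (p : ℝ[X]) :
    Polynomial.aeval (fromBlocks A 0 0 B) p = fromBlocks (Polynomial.aeval A p) 0 0 (Polynomial.aeval B p) := by
  induction p using Polynomial.induction_on' with
  | add p q hp hq => simp [hp, hq, fromBlocks_add]
  | monomial n a =>
    simp [Polynomial.aeval_monomial, fromBlocks_diagonal_pow, Algebra.algebraMap_eq_smul_one, fromBlocks_smul]

lemma cfc_fromBlocks_diagonal {A : Matrix m m ℂ} {B : Matrix k k ℂ} (hA : A.IsHermitian)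
    (hB : B.IsHermitian) (g : ℝ → ℝ) :
    cfc g (fromBlocks A 0 0 B) = fromBlocks (cfc g A) 0 0 (cfc g B) := by
  have hAB : (fromBlocks A 0 0 B).IsHermitian := hA.fromBlocks (by simp) hB
  obtain ⟨p, hp⟩ := (((finite_real_spectrum (A := A)).union (finite_real_spectrum (A := B))).union
    (finite_real_spectrum (A := (fromBlocks A 0 0 B)))).exists_polynomial_eqOn g
  rw [cfc_eq_aeval hA (hp.mono fun x hx => .inl (.inl hx)),
    cfc_eq_aeval hB (hp.mono fun x hx => .inl (.inr hx)),
    cfc_eq_aeval hAB (hp.mono fun x hx => .inr hx), aeval_fromBlocks_diagonal]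

/-- Conjugation by an involution, as an algebra homomorphism. -/
noncomputable def conjInvolution (W : Matrix m m ℂ) (hW : W * W = 1) : Matrix m m ℂ →ₐ[ℝ] Matrix m m ℂ :=
  AlgHom.ofLinearMap
    { toFun := fun A => W * A * W
      map_add' := fun A B => by rw [mul_add, add_mul]
      map_smul' := fun c A => by simp }
    (by simpa using hW)
    (fun A B => by
      change W * (A * B) * W = W * A * W * (W * B * W)
      rw [show W * A * W * (W * B * W) = W * A * (W * W) * B * W by simp only [mul_assoc], hW]
      simp only [mul_one, mul_assoc])

lemma cfc_conj_involution {A W : Matrix m m ℂ} (hA : A.IsHermitian) (hW : W.IsHermitian)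
    (hW1 : W * W = 1) (g : ℝ → ℝ) : cfc g (W * A * W) = W * cfc g A * W := by
  refine (map_cfc (conjInvolution W hW1) hA ?_ g).symm
  change (W * A * W).IsHermitian
  simpa [hW.eq] using isHermitian_mul_mul_conjTranspose W hA

omit [DecidableEq m] [DecidableEq k] in
lemma kronecker_le_kronecker_right {A B : Matrix m m ℂ} {C : Matrix k k ℂ} (h : A ≤ B)
    (hC : C.PosSemidef) : A ⊗ₖ C ≤ B ⊗ₖ C := by
  rw [le_iff] at h ⊢
  have hs : B ⊗ₖ C - A ⊗ₖ C = (B - A) ⊗ₖ C := by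
    ext i j
    simp [sub_mul]
  exact hs ▸ h.kronecker hC

omit [Fintype m] [DecidableEq m] in
lemma PosDef.of_le {A B : Matrix m m ℂ} (hA : A.PosDef) (h : A ≤ B) : B.PosDef := by
  simpa using hA.add_posSemidef (le_iff.1 h)

open scoped Matrix.Norms.L2Operator in
lemma PosDef.inv_le_inv {A B : Matrix m m ℂ} (hA : A.PosDef) (h : A ≤ B) : B⁻¹ ≤ A⁻¹ := by
  have := CStarAlgebra.ringInverse_le_ringInverse h (isStrictlyPositive_iff_posDef.2 hA)
  simpa [nonsing_inv_eq_ringInverse] using this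

open scoped Matrix.Norms.L2Operator in
lemma IsHermitian.exists_le_smul_one {A : Matrix m m ℂ} (hA : A.IsHermitian) :
    ∃ r : ℝ, A ≤ r • 1 := by
  exact ⟨‖A‖, by simpa [Algebra.algebraMap_eq_smul_one] using
    IsSelfAdjoint.le_algebraMap_norm_self hA.isSelfAdjoint⟩

open scoped Matrix.Norms.L2Operator in
lemma le_of_forall_pos_le_add_smul_one {A B : Matrix m m ℂ}
    (h : ∀ r : ℝ, 0 < r → A ≤ B + r • 1) : A ≤ B := by
  have ht : Filter.Tendsto (fun r : ℝ => B + r • (1 : Matrix m m ℂ)) (nhdsWithin 0 (Set.Ioi 0))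
      (nhds B) := by
    have : Continuous fun r : ℝ => B + r • (1 : Matrix m m ℂ) := by fun_prop
    simpa using (this.tendsto 0).mono_left nhdsWithin_le_nhds
  exact ge_of_tendsto ht (eventually_nhdsWithin_of_forall h)

/-- The spectrum of a positive definite matrix is positive. -/
lemma PosDef.spectrum_pos {A : Matrix m m ℂ} (hA : A.PosDef) {x : ℝ} (hx : x ∈ spectrum ℝ A) :
    0 < x :=
  (isStrictlyPositive_iff_posDef.2 hA).spectrum_pos hx

lemma PosDef.cfc_inv {A : Matrix m m ℂ} (hA : A.PosDef) (f : ℝ → ℝ) :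
    cfc f A⁻¹ = cfc (fun x => f x⁻¹) A := by
  have h := cfc_comp_inv (R := ℝ) f hA.isUnit.unit
    ((finite_real_spectrum (A := A)).image _ |>.continuousOn _) hA.isHermitian.isSelfAdjoint
  rw [coe_units_inv] at h
  exact h.symm

/-- A matrix whose off-diagonal blocks are removed dominates the original one, after enlarging the
first diagonal block slightly and the second one sufficiently. -/
lemma exists_fromBlocks_le {P : Matrix m m ℂ} {S : Matrix m k ℂ} {R : Matrix k k ℂ}
    (hR : R.IsHermitian) {ε : ℝ} (hε : 0 < ε) :
    ∃ r : ℝ, 0 < r ∧ fromBlocks P S Sᴴ R ≤ fromBlocks (P + ε • 1) 0 0 (r • 1) := by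
  have hE : (ε • (1 : Matrix m m ℂ)).PosDef := PosDef.one.smul hε
  -- `r` has to dominate this matrix: the Schur complement of `ε • 1` in the difference of the two
  -- sides is `r • 1` minus it.
  have hH : (R + Sᴴ * (ε • (1 : Matrix m m ℂ))⁻¹ * S).IsHermitian :=
    hR.add (isHermitian_conjTranspose_mul_mul S hE.inv.isHermitian)
  obtain ⟨r, hr⟩ := hH.exists_le_smul_one
  refine ⟨max r 1, by positivity, ?_⟩
  rw [le_iff, sub_eq_add_neg, fromBlocks_neg, fromBlocks_add]
  have hS : (0 : Matrix k m ℂ) + -Sᴴ = (-S)ᴴ := by simp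
  rw [hS, zero_add, add_right_comm, add_neg_cancel, zero_add]
  have := hE.isUnit.invertible
  rw [PosDef.fromBlocks₁₁ _ _ hE]
  have hr' : (r • (1 : Matrix k k ℂ)) ≤ (max r 1) • 1 := by
    rw [le_iff, ← sub_smul]
    exact PosSemidef.one.smul (sub_nonneg.2 (le_max_left _ _))
  have h := le_iff.1 (hr.trans hr')
  have hSE : (-S)ᴴ * (ε • (1 : Matrix m m ℂ))⁻¹ * (-S) = Sᴴ * (ε • (1 : Matrix m m ℂ))⁻¹ * S := by
    rw [conjTranspose_neg, Matrix.neg_mul, Matrix.neg_mul, Matrix.mul_neg, neg_neg]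
  rwa [← sub_eq_add_neg, hSE, sub_sub]


omit [Fintype m] [DecidableEq m] in
lemma posDef_smul_add_smul {A B : Matrix m m ℂ} (hA : A.PosDef) (hB : B.PosDef) {a b : ℝ}
    (ha : 0 < a) (hb : 0 < b) : (a • A + b • B).PosDef :=
  (hA.smul ha).add (hB.smul hb)

end Matrix

/-! ### Operator monotonicity and concavity of `x ↦ f x⁻¹`. -/

namespace OperatorAntiMonotone

variable {f : ℝ → ℝ} {m : Type*} [Fintype m] [DecidableEq m]

lemma cfc_le_cfc (hf : OperatorAntiMonotone f) {A B : Matrix m m ℂ} (hA : A.PosDef) (h : A ≤ B) :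
    cfc f B ≤ cfc f A := by
  have hB := hA.of_le h
  let e := (Fintype.equivFin m).symm
  have key := hf _ (A.submatrix e e) (B.submatrix e e) (hA.submatrix e.injective)
    (hB.submatrix e.injective) ((posSemidef_submatrix_equiv e).2 h)
  rw [cfc_submatrix_equiv hA.isHermitian, cfc_submatrix_equiv hB.isHermitian] at key
  exact (posSemidef_submatrix_equiv e).1 key

/-- If `f` is operator anti-monotone, then `x ↦ f x⁻¹` is operator monotone. -/
lemma cfc_inv_le_cfc_inv (hf : OperatorAntiMonotone f) {A B : Matrix m m ℂ} (hA : A.PosDef)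
    (h : A ≤ B) : cfc (fun x => f x⁻¹) A ≤ cfc (fun x => f x⁻¹) B := by
  rw [← hA.cfc_inv, ← (hA.of_le h).cfc_inv]
  exact hf.cfc_le_cfc (hA.of_le h).inv (hA.inv_le_inv h)

/-- The inequality of operator concavity for `x ↦ f x⁻¹`, up to a small shift of the argument. -/
lemma smul_cfc_inv_add_le_shift (hf : OperatorAntiMonotone f) {A B : Matrix m m ℂ}
    (hA : A.PosDef) (hB : B.PosDef) {a b : ℝ} (ha : 0 < a) (hb : 0 < b) (hab : a + b = 1)
    {ε : ℝ} (hε : 0 < ε) :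
    a • cfc (fun x => f x⁻¹) A + b • cfc (fun x => f x⁻¹) B ≤
      cfc (fun x => f x⁻¹) (a • A + b • B + ε • 1) := by
  set g : ℝ → ℝ := fun x => f x⁻¹
  -- A Hermitian involution because `a + b = 1`.
  set W : Matrix (m ⊕ m) (m ⊕ m) ℂ := fromBlocks (√a • 1) (√b • 1) (√b • 1) (-(√a • 1)) with hW
  have haa : √a * √a = a := Real.mul_self_sqrt ha.le
  have hbb : √b * √b = b := Real.mul_self_sqrt hb.le
  have hWW : W * W = 1 := by
    rw [hW, fromBlocks_multiply, ← fromBlocks_one]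
    congr 1 <;> simp [smul_smul, haa, hbb, ← add_smul, hab, mul_comm (√b), add_comm b]
  have hWH : W.IsHermitian := by
    simp [hW, IsHermitian, fromBlocks_conjTranspose, conjTranspose_smul]
  have hconj : ∀ M N : Matrix m m ℂ, W * fromBlocks M 0 0 N * W =
      fromBlocks (a • M + b • N) ((√a * √b) • (M - N)) ((√a * √b) • (M - N))
        (b • M + a • N) := by
    intro M N
    rw [hW, fromBlocks_multiply, fromBlocks_multiply]
    congr 1 <;> simp [smul_smul, haa, hbb, mul_comm (√b), sub_eq_add_neg]
  have hT : (fromBlocks A 0 0 B).PosDef := by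
    have := hA.isUnit.invertible
    refine PosSemidef.posDef_iff_isUnit ?_ |>.2 ?_
    · have := (PosDef.fromBlocks₁₁ (0 : Matrix m m ℂ) B hA).2 (by simpa using hB.posSemidef)
      simpa using this
    · rw [isUnit_iff_isUnit_det, det_fromBlocks_zero₂₁]
      exact ((isUnit_iff_isUnit_det _).1 hA.isUnit).mul ((isUnit_iff_isUnit_det _).1 hB.isUnit)
  have hTW : (W * fromBlocks A 0 0 B * W).PosDef := by
    have hWu : IsUnit W := IsUnit.of_mul_eq_one _ hWW
    have := (IsUnit.posDef_star_left_conjugate_iff hWu (x := fromBlocks A 0 0 B)).2 hT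
    rwa [star_eq_conjTranspose, hWH.eq] at this
  have hS : ((√a * √b) • (A - B))ᴴ = (√a * √b) • (A - B) := by
    rw [conjTranspose_smul, (hA.isHermitian.sub hB.isHermitian).eq, star_trivial]
  obtain ⟨r, hr, hle⟩ := exists_fromBlocks_le (P := a • A + b • B) (S := (√a * √b) • (A - B))
    (posDef_smul_add_smul hA hB hb ha).isHermitian hε
  rw [hS, ← hconj A B] at hle
  have key := hf.cfc_inv_le_cfc_inv hTW hle
  rw [cfc_conj_involution hT.isHermitian hWH hWW,
    cfc_fromBlocks_diagonal hA.isHermitian hB.isHermitian, hconj,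
    cfc_fromBlocks_diagonal
      ((posDef_smul_add_smul hA hB ha hb).add (PosDef.one.smul hε)).isHermitian
      (PosDef.one.smul hr).isHermitian] at key
  -- Compression to the upper left corner discards the uncontrolled `r`.
  exact (le_iff.1 key).submatrix Sum.inl

/-- `x ↦ f x⁻¹` is increasing and almost concave on `(0,∞)`. -/
lemma inv_le_inv (hf : OperatorAntiMonotone f) {x y : ℝ} (hx : 0 < x) (hxy : x ≤ y) :
    f x⁻¹ ≤ f y⁻¹ := by
  have key := hf.cfc_inv_le_cfc_inv (m := Unit) (A := x • 1) (B := y • 1) (PosDef.one.smul hx)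
    (by rw [le_iff, ← sub_smul]; exact PosSemidef.one.smul (sub_nonneg.2 hxy))
  simp only [← Algebra.algebraMap_eq_smul_one, cfc_algebraMap] at key
  have := (le_iff.1 key).diag_nonneg (i := ())
  simpa [algebraMap_matrix_apply, ← Complex.ofReal_sub] using this

lemma smul_inv_add_le_shift (hf : OperatorAntiMonotone f) {x y a b ε : ℝ} (hx : 0 < x)
    (hy : 0 < y) (ha : 0 < a) (hb : 0 < b) (hab : a + b = 1) (hε : 0 < ε) :
    a * f x⁻¹ + b * f y⁻¹ ≤ f (a * x + b * y + ε)⁻¹ := by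
  have key := hf.smul_cfc_inv_add_le_shift (m := Unit) (A := x • 1) (B := y • 1)
    (PosDef.one.smul hx) (PosDef.one.smul hy) ha hb hab hε
  simp only [smul_smul, ← add_smul] at key
  simp only [← Algebra.algebraMap_eq_smul_one, cfc_algebraMap] at key
  have := (le_iff.1 key).diag_nonneg (i := ())
  simpa [algebraMap_matrix_apply, ← Complex.ofReal_sub, ← Complex.ofReal_mul,
    ← Complex.ofReal_add] using this

/-- `x ↦ f x⁻¹` is continuous from the right on `(0,∞)`. -/
lemma exists_shift_le (hf : OperatorAntiMonotone f) {x η : ℝ} (hx : 0 < x) (hη : 0 < η) :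
    ∃ δ : ℝ, 0 < δ ∧ ∀ ε ≤ δ, 0 < ε → f (x + ε)⁻¹ ≤ f x⁻¹ + η := by
  set c := f x⁻¹ - f (x / 2)⁻¹
  have hc : 0 ≤ c := sub_nonneg.2 (hf.inv_le_inv (by positivity) (by linarith))
  -- This makes `b * c ≤ (1 - b) * η`, the bound needed when `x` is written as a combination of `x +
  -- ε` and `x / 2` plus a positive shift.
  obtain ⟨b, hb, hb1, hbc⟩ : ∃ b : ℝ, 0 < b ∧ b < 1 ∧ b * (c + η) = η / 2 := by
    refine ⟨η / 2 / (c + η), by positivity, ?_, by field_simp⟩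
    rw [div_lt_one (by positivity)]
    linarith
  refine ⟨b * x / 4, by positivity, fun ε hε hε0 => ?_⟩
  have h := hf.smul_inv_add_le_shift (x := x + ε) (y := x / 2) (a := 1 - b) (b := b)
    (ε := b * x / 2 - (1 - b) * ε) (by positivity) (by positivity) (by linarith) hb (by ring)
    (by nlinarith [mul_pos hb hε0, mul_pos hb hx])
  rw [show (1 - b) * (x + ε) + b * (x / 2) + (b * x / 2 - (1 - b) * ε) = x by ring] at h
  have h1 : (1 - b) * (f (x + ε)⁻¹ - f x⁻¹ - η) ≤ 0 := by
    simp only [c] at hbc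
    nlinarith
  nlinarith [sub_pos.2 hb1]

/-- If `f` is operator anti-monotone, then `x ↦ f x⁻¹` is operator concave. -/
lemma smul_cfc_inv_add_le (hf : OperatorAntiMonotone f) {A B : Matrix m m ℂ}
    (hA : A.PosDef) (hB : B.PosDef) {a b : ℝ} (ha : 0 < a) (hb : 0 < b) (hab : a + b = 1) :
    a • cfc (fun x => f x⁻¹) A + b • cfc (fun x => f x⁻¹) B ≤
      cfc (fun x => f x⁻¹) (a • A + b • B) := by
  refine le_of_forall_pos_le_add_smul_one fun η hη => ?_
  have hP := posDef_smul_add_smul hA hB ha hb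
  set P := a • A + b • B
  -- One `ε` serves all eigenvalues, as there are finitely many.
  obtain ⟨ε, hε, hε'⟩ : ∃ ε : ℝ, 0 < ε ∧ ∀ x ∈ spectrum ℝ P, f (x + ε)⁻¹ ≤ f x⁻¹ + η := by
    have hev : ∀ x ∈ spectrum ℝ P, ∀ᶠ ε in nhdsWithin (0 : ℝ) (Set.Ioi 0),
        f (x + ε)⁻¹ ≤ f x⁻¹ + η := by
      intro x hx
      obtain ⟨δ, hδ, h⟩ := hf.exists_shift_le (hP.spectrum_pos hx) hη
      filter_upwards [Ioc_mem_nhdsGT hδ] with ε hε using h ε hε.2 hε.1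
    obtain ⟨ε, h, hε⟩ := (((finite_real_spectrum (A := P)).eventually_all.2 hev).and
      self_mem_nhdsWithin).exists
    exact ⟨ε, hε, h⟩
  refine (hf.smul_cfc_inv_add_le_shift hA hB ha hb hab hε).trans ?_
  have hPs : IsSelfAdjoint P := hP.isHermitian.isSelfAdjoint
  have hcont : ∀ g : ℝ → ℝ, ContinuousOn g (spectrum ℝ P) :=
    fun g => (finite_real_spectrum (A := P)).continuousOn g
  have h1 : P + ε • 1 = cfc (fun x => x + ε) P := by
    rw [cfc_add_const ε (fun x => x) P, cfc_id' ℝ P, Algebra.algebraMap_eq_smul_one]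
  have h2 : cfc (fun x => f x⁻¹) P + η • 1 = cfc (fun x => f x⁻¹ + η) P := by
    rw [cfc_add_const η (fun x => f x⁻¹) P (hcont _), Algebra.algebraMap_eq_smul_one]
  rw [h1, h2, ← cfc_comp' (fun x => f x⁻¹) (fun x => x + ε) P
    ((finite_real_spectrum (A := P)).image _ |>.continuousOn _)]
  exact cfc_mono hε' (hcont _) (hcont _)

end OperatorAntiMonotone

/-! ### The divergence as a function of `τ`. -/

section OptimizedDivergence

variable {f : ℝ → ℝ} {n : Type*} [Fintype n] [DecidableEq n]

lemma optQAt_eq_cfc_inv (f : ℝ → ℝ) (X : Matrix n n ℂ) {Y τ : Matrix n n ℂ} (hY : Y.PosDef)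
    (hτ : τ.PosDef) :
    optQAt f X Y τ = (star (phiVec X) ⬝ᵥ
      (cfc (fun x => f x⁻¹) (τ ⊗ₖ Y.transpose⁻¹)).mulVec (phiVec X)).re := by
  rw [← (hτ.kronecker hY.transpose.inv).cfc_inv, inv_kronecker, optQAt,
    nonsing_inv_nonsing_inv _ ((isUnit_iff_isUnit_det _).1 hY.transpose.isUnit)]

omit [DecidableEq n] in
lemma Matrix.re_dotProduct_mulVec_mono {A B : Matrix n n ℂ} (h : A ≤ B) (v : n → ℂ) :
    (star v ⬝ᵥ A.mulVec v).re ≤ (star v ⬝ᵥ B.mulVec v).re := by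
  have := (Complex.le_def.1 ((le_iff.1 h).dotProduct_mulVec_nonneg v)).1
  simpa [sub_mulVec, dotProduct_sub] using this

lemma optQAt_mono (hf : OperatorAntiMonotone f) (X : Matrix n n ℂ) {Y σ τ : Matrix n n ℂ}
    (hY : Y.PosDef) (hσ : σ.PosDef) (h : σ ≤ τ) : optQAt f X Y σ ≤ optQAt f X Y τ := by
  rw [optQAt_eq_cfc_inv f X hY hσ, optQAt_eq_cfc_inv f X hY (hσ.of_le h)]
  exact re_dotProduct_mulVec_mono (hf.cfc_inv_le_cfc_inv (hσ.kronecker hY.transpose.inv)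
    (kronecker_le_kronecker_right h hY.transpose.inv.posSemidef)) _

lemma concaveOn_optQAt (hf : OperatorAntiMonotone f) (X : Matrix n n ℂ) {Y : Matrix n n ℂ}
    (hY : Y.PosDef) :
    ConcaveOn ℝ {τ : Matrix n n ℂ | τ.PosDef} (fun τ => optQAt f X Y τ) := by
  refine concaveOn_iff_forall_pos.2 ⟨convex_iff_forall_pos.2 fun σ hσ τ hτ a b ha hb _ =>
    posDef_smul_add_smul hσ hτ ha hb, fun σ hσ τ hτ a b ha hb hab => ?_⟩
  have hY' := hY.transpose.inv
  have key := re_dotProduct_mulVec_mono (hf.smul_cfc_inv_add_le (PosDef.kronecker hσ hY')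
    (PosDef.kronecker hτ hY') ha hb hab) (phiVec X)
  rw [optQAt_eq_cfc_inv f X hY hσ, optQAt_eq_cfc_inv f X hY hτ,
    optQAt_eq_cfc_inv f X hY (posDef_smul_add_smul hσ hτ ha hb), add_kronecker,
    smul_kronecker, smul_kronecker]
  simpa [add_mulVec, smul_mulVec, dotProduct_add] using key

/-- A matrix of trace at most one lies below a matrix of trace one. -/
lemma Matrix.exists_le_trace_eq_one [Nonempty n] {τ : Matrix n n ℂ} (h : τ.trace ≤ 1) :
    ∃ σ : Matrix n n ℂ, τ ≤ σ ∧ σ.trace = 1 := by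
  -- The missing trace is spread evenly over the identity.
  refine ⟨τ + ((1 - τ.trace) / Fintype.card n) • 1, ?_, ?_⟩
  · rw [le_iff, add_sub_cancel_left]
    exact PosSemidef.one.smul (div_nonneg (sub_nonneg.2 h) (Nat.cast_nonneg _))
  · simp

end OptimizedDivergence

theorem mainTheorem2 {n : Type*} [Fintype n] [DecidableEq n] [Nonempty n]
    (f : ℝ → ℝ) (hf : OperatorAntiMonotone f)
    (X Y : Matrix n n ℂ) (hX : X.PosDef) (hY : Y.PosDef) :
    optQ f X Y =
        ⨆ τ ∈ {τ : Matrix n n ℂ | τ.PosDef ∧ τ.trace = 1}, (optQAt f X Y τ : EReal) ∧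
      ConcaveOn ℝ {τ : Matrix n n ℂ | τ.PosDef} (fun τ => optQAt f X Y τ) := by
  refine ⟨le_antisymm (iSup₂_le fun τ hτ => ?_) (iSup₂_le fun τ hτ => ?_),
    concaveOn_optQAt hf X hY⟩
  · obtain ⟨σ, hle, hσ⟩ := exists_le_trace_eq_one hτ.2
    exact (EReal.coe_le_coe_iff.2 (optQAt_mono hf X hY hτ.1 hle)).trans
      (le_iSup₂ (f := fun (τ : Matrix n n ℂ)
        (_ : τ ∈ {τ : Matrix n n ℂ | τ.PosDef ∧ τ.trace = 1}) => (optQAt f X Y τ : EReal))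
        σ ⟨hτ.1.of_le hle, hσ⟩)
  · exact le_iSup₂ (f := fun (τ : Matrix n n ℂ)
      (_ : τ ∈ {τ : Matrix n n ℂ | τ.PosDef ∧ τ.trace ≤ 1}) => (optQAt f X Y τ : EReal))
      τ ⟨hτ.1, hτ.2.le⟩
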